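/- **Proposition.** Let $d\in\mathbb N$. For $\ell,L>0$ let $\mathcal S_{\ell,L}(\mathbb R^d)$ be the class of differentiable functions $W:\mathbb R^d\to\mathbb R$ such that for all $x_1,x_2\in\mathbb R^d$, $t\in[0,1]$, $$W((1-t)x_1+tx_2)\le(1-t)W(x_1)+tW(x_2)-\tfrac{\ell}{2}t(1-t)\|x_1-x_2\|^2,\qquad \|\nabla W(x_2)-\nabla W(x_1)\|\le L\|x_2-x_1\|.$$ Let $U\in\mathcal S_{\ell_U,L_U}(\mathbb R^d)$ and $V\in\mathcal S_{\ell_V,L_V}(\mathbb R^d)$, where $V$ is three times differentiable with $\sup_p\|\nabla^3V(p)\|\le T_V<\infty$ (operator norm of a trilinear form). Put $H(q,p)=U(q)+V(p)$, and let $\mathsf P$ be the probability measure on $\mathbb R^d\times\mathbb R^d$ with density proportional to $e^{-H(q,p)}$. Given potentials $S_0,S_1,\dots$ on $\mathbb R^d$, a step size $\eta>0$, an integer $K\ge1$ and a start $(q_0,p_0)$, define the leapfrog proposal $(q_K,p_K)$ by $$p_{k+\frac12}=p_k-\tfrac\eta2\nabla S_k(q_k),\quad q_{k+1}=q_k+\eta\nabla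 V(p_{k+\frac12}),\quad p_{k+1}=p_{k+\frac12}-\tfrac\eta2\nabla S_{k+1}(q_{k+1}),\qquad 0\le k<K,$$ and its Metropolis–Hastings acceptance probability by $A^{S}_{K,\eta}(q_0,p_0)=\exp\big(\min\{0,\,H(q_0,p_0)-H(q_K,p_K)\}\big)$. 1. (Exact gradients.) Suppose that $U$ is three times differentiable with $\sup_q\|\nabla^3U(q)\|\le T_U<\infty$, and take $S_k=U$ for all $k$. Then for all $\varrho,\delta\in(0,1)$ and every $K\ge1$ there is $\eta_0>0$ such that for every $\eta\in(0,\eta_0]$ there is a measurable set $D\subseteq\mathbb R^d\times\mathbb R^d$ with $\mathsf P(D)\ge1-\delta$ and $A^{S}_{K,\eta}(q,p)\ge\varrho$ for all $(q,p)\in D$. 2. (Stochastic gradients.) Let $S_k=U^{\omega}_k$, $k\ge0$, be random potentials on a probability space (independent of $(q_0,p_0)$, with arbitrary dependence among each other) such that $\nabla U_k^\omega(q)$ is a random vector for each $q$, and suppose that there are constants $0<\underline\ell\le\bar L<\infty$ and $\bar T>0$ such that, for each $k$, almost surely $U^\omega_k\in\mathcal S_{\ell^\omega,L^\omega}(\mathbb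 R^d)$ for some $\ell^\omega\ge\underline\ell$, $L^\omega\le\bar L$, and $U_k^\omega$ is three times differentiable with $\sup_q\|\nabla^3U_k^\omega(q)\|\le\bar T$. Then for all $\varrho,\delta\in(0,1)$ and every $K\ge1$ there is $\eta_0>0$ such that for every $\eta\in(0,\eta_0]$ there is a measurable set $D\subseteq\mathbb R^d\times\mathbb R^d$ with $\mathsf P(D)\ge1-\delta$ such that, for all $(q,p)\in D$, the probability $\mathbb E_\omega[A^{S}_{K,\eta}(q,p)]$ that the proposal from $(q,p)$ is accepted is at least $\varrho$, and moreover $A^{S}_{K,\eta}(q,p)\ge\varrho$ with probability at least $1-\delta$ over the gradient noise. -/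

import Mathlib

open MeasureTheory

noncomputable section

namespace HMC

/-- The position space and the momentum space `ℝᵈ`, with the Euclidean norm. -/
abbrev Space (d : ℕ) : Type := EuclideanSpace ℝ (Fin d)

/-- The class `𝒮_{ℓ,L}(ℝᵈ)`: differentiable, `ℓ`-strongly convex, with `L`-Lipschitz gradient. -/
structure InClassS {d : ℕ} (l L : ℝ) (W : Space d → ℝ) : Prop where
  l_pos : 0 < l
  L_pos : 0 < L
  differentiable : Differentiable ℝ W
  strongConvex : ∀ x₁ x₂ : Space d, ∀ t ∈ Set.Icc (0 : ℝ) 1,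
    W ((1 - t) • x₁ + t • x₂) ≤
      (1 - t) * W x₁ + t * W x₂ - l / 2 * t * (1 - t) * ‖x₁ - x₂‖ ^ 2
  gradient_lipschitz : ∀ x₁ x₂ : Space d,
    ‖gradient W x₂ - gradient W x₁‖ ≤ L * ‖x₂ - x₁‖

/-- `W` is three times differentiable and the operator norm of its third derivative (as a
trilinear form for the Euclidean norm) is at most `T` everywhere. -/
structure ThirdDerivBound {d : ℕ} (T : ℝ) (W : Space d → ℝ) : Prop where
  T_pos : 0 < T
  contDiff_two : ContDiff ℝ 2 W
  differentiable_second : Differentiable ℝ (iteratedFDeriv ℝ 2 W)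
  bound : ∀ x, ‖iteratedFDeriv ℝ 3 W x‖ ≤ T

/-- The probability measure on `ℝᵈ` with density proportional to `exp (-W)`. -/
def gibbs {d : ℕ} (W : Space d → ℝ) : Measure (Space d) :=
  (volume : Measure (Space d)).tilted (fun x => -W x)

/-- The joint law of `(q, p)`, where `q ∼ exp (-U)` and `p ∼ exp (-V)` are independent. -/
def jointLaw {d : ℕ} (U V : Space d → ℝ) : Measure (Space d × Space d) :=
  (gibbs U).prod (gibbs V)

/-- The Hamiltonian `H(q, p) = U(q) + V(p)`. -/
def hamiltonian {d : ℕ} (U V : Space d → ℝ) (z : Space d × Space d) : ℝ :=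
  U z.1 + V z.2

/-- One leapfrog step of size `η`, where `G` is the gradient field used at the current position
and `G'` the one used at the new position:
`p_{1/2} = p - (η/2) G(q)`, `q' = q + η ∇V(p_{1/2})`, `p' = p_{1/2} - (η/2) G'(q')`. -/
def leapfrogStep {d : ℕ} (G G' : Space d → Space d) (V : Space d → ℝ) (η : ℝ)
    (z : Space d × Space d) : Space d × Space d :=
  let pHalf := z.2 - (η / 2) • G z.1
  let q' := z.1 + η • gradient V pHalf
  (q', pHalf - (η / 2) • G' q')

/-- The state `(q_K, p_K)` after `K` leapfrog steps started at `z`, when the gradient at the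
position `q_k` is computed with the potential `S k`. In particular the same sample `S (k + 1)`
closes step `k` and opens step `k + 1`. -/
def leapfrog {d : ℕ} (S : ℕ → Space d → ℝ) (V : Space d → ℝ) (η : ℝ)
    (z : Space d × Space d) : ℕ → Space d × Space d
  | 0 => z
  | k + 1 => leapfrogStep (gradient (S k)) (gradient (S (k + 1))) V η (leapfrog S V η z k)

/-- The Metropolis-Hastings acceptance probability of the proposal `(q_K, p_K)` obtained from
`z = (q_0, p_0)` with the potentials `S k` in the leapfrog integrator:
`log A = min {0, H(q_0, p_0) - H(q_K, p_K)}`. The Hamiltonian always uses the exact `U`. -/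
def acceptProbWith {d : ℕ} (U V : Space d → ℝ) (S : ℕ → Space d → ℝ) (K : ℕ) (η : ℝ)
    (z : Space d × Space d) : ℝ :=
  Real.exp (min 0 (hamiltonian U V z - hamiltonian U V (leapfrog S V η z K)))

/-- The acceptance probability `A_{K,η}(q_0, p_0)` of HMC with exact gradients. -/
def acceptProb {d : ℕ} (U V : Space d → ℝ) (K : ℕ) (η : ℝ) (z : Space d × Space d) : ℝ :=
  acceptProbWith U V (fun _ => U) K η z

/-- The assumption on the stochastic gradients. `S k ω` is the random potential `U^ω` drawn for
the `k`-th gradient evaluation. Independence of the draws is not required: independent draws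
with a common law, and one draw kept along the whole trajectory, are both special cases. -/
structure StochasticGradient {d : ℕ} {Ω : Type*} [MeasurableSpace Ω] (μ : Measure Ω)
    (l L T : ℝ) (S : ℕ → Ω → Space d → ℝ) : Prop where
  l_pos : 0 < l
  l_le_L : l ≤ L
  T_pos : 0 < T
  measurable_gradient : ∀ k q, Measurable (fun ω => gradient (S k ω) q)
  classS : ∀ k, ∀ᵐ ω ∂μ, ∃ lω Lω : ℝ, l ≤ lω ∧ Lω ≤ L ∧ InClassS lω Lω (S k ω)
  thirdDeriv : ∀ k, ∀ᵐ ω ∂μ, ThirdDerivBound T (S k ω)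

end HMC

end

/-!
At step size `η = 0` the leapfrog map is the identity, so every proposal is accepted with
probability one. For continuously differentiable potentials the acceptance probability is jointly
continuous in `η` and the starting point, so by compactness it stays above any level `ϱ < 1`,
uniformly over a compact set of starting points, as soon as `η` is small; the Gibbs measure is
tight, so this compact set may be taken to carry mass `1 - δ`. With stochastic gradients the
threshold for `η` depends on the noise `ω`, but it is almost surely positive, hence bounded below
with probability as close to one as desired. If the proposal is accepted with probability at
least `s` on a noise event of probability at least `s`, its mean acceptance probability is at least
`s²` by Markov's inequality, so the choice `s² = max ϱ (1 - δ)` gives both bounds.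
-/

namespace HMC

open Filter Set Topology
open scoped ENNReal

section Convexity

theorem add_fderiv_add_le_of_uniformConvexOn {E : Type*} [NormedAddCommGroup E] [NormedSpace ℝ E]
    {s : Set E} {φ : ℝ → ℝ} {f : E → ℝ} (hf : UniformConvexOn s φ f) {x y : E} (hx : x ∈ s)
    (hy : y ∈ s) (hd : DifferentiableAt ℝ f x) :
    f x + fderiv ℝ f x (y - x) + φ ‖y - x‖ ≤ f y := by
  have hslope : Tendsto (fun t : ℝ => t⁻¹ • (f (x + t • (y - x)) - f x)) (𝓝[>] 0)
      (𝓝 (fderiv ℝ f x (y - x))) :=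
    hd.hasFDerivAt.hasLineDerivAt (y - x) |>.tendsto_slope_zero_right
  have hbound : Tendsto (fun t : ℝ => f y - f x - (1 - t) * φ ‖y - x‖) (𝓝[>] 0)
      (𝓝 (f y - f x - (1 - 0) * φ ‖y - x‖)) :=
    (Continuous.tendsto (by fun_prop) 0).mono_left nhdsWithin_le_nhds
  have hle := le_of_tendsto_of_tendsto hslope hbound <| by
    filter_upwards [Ioo_mem_nhdsGT (zero_lt_one (α := ℝ))] with t ht
    have hconv := hf.2 hy hx ht.1.le (sub_nonneg.2 ht.2.le) (add_sub_cancel t 1)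
    rw [show t • y + (1 - t) • x = x + t • (y - x) by module] at hconv
    simp only [smul_eq_mul] at hconv ⊢
    rw [inv_mul_le_iff₀ ht.1]
    linarith
  linarith

variable {E : Type*} [NormedAddCommGroup E] [InnerProductSpace ℝ E] [FiniteDimensional ℝ E]
  [MeasurableSpace E] [BorelSpace E]

theorem integrable_exp_neg_of_quadratic_le {f : E → ℝ} (hf : AEStronglyMeasurable f)
    {a b : ℝ} (hb : 0 < b) {v : E} (hle : ∀ x, a + inner ℝ v x + b * ‖x‖ ^ 2 ≤ f x) :
    Integrable (fun x => Real.exp (-f x)) := by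
  have hgauss := (GaussianFourier.integrable_cexp_neg_mul_sq_norm_add
    (b := b) (by simpa using hb) (-1) v).norm.const_mul (Real.exp (-a))
  refine hgauss.mono' (Real.continuous_exp.comp_aestronglyMeasurable hf.neg)
    (ae_of_all _ fun x => ?_)
  have hre : (-(b : ℂ) * (‖x‖ : ℂ) ^ 2 + -1 * ((inner ℝ v x : ℝ) : ℂ)).re
      = -b * ‖x‖ ^ 2 - inner ℝ v x := by
    rw [← Complex.ofReal_re (-b * ‖x‖ ^ 2 - inner ℝ v x)]
    congr 1
    push_cast
    ring
  rw [Real.norm_eq_abs, Real.abs_exp, Complex.norm_exp, ← Real.exp_add, Real.exp_le_exp, hre]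
  linarith [hle x]

theorem integrable_exp_neg_of_strongConvexOn {m : ℝ} (hm : 0 < m) {f : E → ℝ}
    (hf : StrongConvexOn univ m f) (hd : Differentiable ℝ f) :
    Integrable (fun x => Real.exp (-f x)) := by
  refine integrable_exp_neg_of_quadratic_le (a := f 0) (v := gradient f 0)
    hd.continuous.aestronglyMeasurable (half_pos hm) fun x => ?_
  simpa only [sub_zero, inner_gradient_left] using
    add_fderiv_add_le_of_uniformConvexOn hf (mem_univ 0) (mem_univ x) (hd 0)

end Convexity

section Gradient

variable {E : Type*} [NormedAddCommGroup E] [InnerProductSpace ℝ E] [CompleteSpace E] {f : E → ℝ}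

theorem contDiff_one_iff_continuous_gradient :
    ContDiff ℝ 1 f ↔ Differentiable ℝ f ∧ Continuous (gradient f) := by
  rw [contDiff_one_iff_fderiv, ← toDual_comp_gradient,
    (InnerProductSpace.toDual ℝ E).comp_continuous_iff]

theorem continuous_gradient (hf : ContDiff ℝ 1 f) : Continuous (gradient f) :=
  (contDiff_one_iff_continuous_gradient.1 hf).2

end Gradient

namespace InClassS

variable {d : ℕ} {l L : ℝ} {W : Space d → ℝ}

theorem contDiff_one (h : InClassS l L W) : ContDiff ℝ 1 W := by
  have hlip : LipschitzWith L.toNNReal (gradient W) :=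
    LipschitzWith.of_dist_le' fun x y => by
      simpa only [dist_eq_norm] using h.gradient_lipschitz y x
  exact contDiff_one_iff_continuous_gradient.2 ⟨h.differentiable, hlip.continuous⟩

theorem strongConvexOn (h : InClassS l L W) : StrongConvexOn univ l W := by
  refine ⟨convex_univ, fun x _ y _ a b _ hb hab => ?_⟩
  obtain rfl : a = 1 - b := by linarith
  have hconv := h.strongConvex x y b ⟨hb, by linarith⟩
  simp only [smul_eq_mul]
  linarith

theorem integrable_exp_neg (h : InClassS l L W) : Integrable (fun x => Real.exp (-W x)) :=
  integrable_exp_neg_of_strongConvexOn h.l_pos h.strongConvexOn h.differentiable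

end InClassS

theorem StochasticGradient.ae_contDiff_one {d : ℕ} {Ω : Type*} [MeasurableSpace Ω] {μ : Measure Ω}
    {l L T : ℝ} {S : ℕ → Ω → Space d → ℝ} (h : StochasticGradient μ l L T S) (k : ℕ) :
    ∀ᵐ ω ∂μ, ContDiff ℝ 1 (S k ω) :=
  (h.classS k).mono fun _ ⟨_, _, _, _, hω⟩ => hω.contDiff_one

theorem isProbabilityMeasure_jointLaw {d : ℕ} {U V : Space d → ℝ}
    (hU : Integrable fun x => Real.exp (-U x)) (hV : Integrable fun x => Real.exp (-V x)) :
    IsProbabilityMeasure (jointLaw U V) := by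
  have : IsProbabilityMeasure (gibbs U) := isProbabilityMeasure_tilted hU
  have : IsProbabilityMeasure (gibbs V) := isProbabilityMeasure_tilted hV
  exact inferInstanceAs (IsProbabilityMeasure ((gibbs U).prod (gibbs V)))

theorem exists_isCompact_le_jointLaw {d : ℕ} {U V : Space d → ℝ}
    (hU : Integrable fun x => Real.exp (-U x)) (hV : Integrable fun x => Real.exp (-V x))
    {δ : ℝ} (hδ : 0 < δ) :
    ∃ D : Set (Space d × Space d), IsCompact D ∧ ENNReal.ofReal (1 - δ) ≤ jointLaw U V D := by
  have := isProbabilityMeasure_jointLaw hU hV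
  have hlt : ENNReal.ofReal (1 - δ) < jointLaw U V univ := by
    rw [measure_univ, ENNReal.ofReal_lt_one]
    exact sub_lt_self 1 hδ
  obtain ⟨D, -, hD, hDδ⟩ := isOpen_univ.exists_lt_isCompact hlt
  exact ⟨D, hD, hDδ.le⟩

section SmallStepSize

variable {d : ℕ} {U V : Space d → ℝ} {S : ℕ → Space d → ℝ}

theorem leapfrog_zero_stepSize (S : ℕ → Space d → ℝ) (V : Space d → ℝ) (z : Space d × Space d)
    (K : ℕ) : leapfrog S V 0 z K = z := by
  induction K with
  | zero => rfl
  | succ K ih => simp [leapfrog, leapfrogStep, ih]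

theorem acceptProbWith_zero_stepSize (U V : Space d → ℝ) (S : ℕ → Space d → ℝ) (K : ℕ)
    (z : Space d × Space d) : acceptProbWith U V S K 0 z = 1 := by
  simp [acceptProbWith, leapfrog_zero_stepSize]

theorem continuous_leapfrog (hV : Continuous (gradient V)) (hS : ∀ k, Continuous (gradient (S k)))
    (K : ℕ) : Continuous fun x : ℝ × Space d × Space d => leapfrog S V x.1 x.2 K := by
  induction K with
  | zero => exact continuous_snd
  | succ K ih =>
    simp only [leapfrog, leapfrogStep]
    fun_prop

theorem continuous_hamiltonian (hU : Continuous U) (hV : Continuous V) :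
    Continuous (hamiltonian U V) :=
  (hU.comp continuous_fst).add (hV.comp continuous_snd)

theorem continuous_acceptProbWith (hU : Continuous U) (hV : ContDiff ℝ 1 V)
    (hS : ∀ k, ContDiff ℝ 1 (S k)) (K : ℕ) :
    Continuous fun x : ℝ × Space d × Space d => acceptProbWith U V S K x.1 x.2 := by
  have hH := continuous_hamiltonian hU hV.continuous
  have hflow := continuous_leapfrog (continuous_gradient hV) (fun k => continuous_gradient (hS k)) K
  unfold acceptProbWith
  fun_prop

theorem eventually_forall_le_acceptProbWith (hU : Continuous U) (hV : ContDiff ℝ 1 V)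
    (hS : ∀ k, ContDiff ℝ 1 (S k)) (K : ℕ) {Z : Set (Space d × Space d)} (hZ : IsCompact Z)
    {ϱ : ℝ} (hϱ : ϱ < 1) :
    ∀ᶠ η in 𝓝[>] 0, ∀ z ∈ Z, ϱ ≤ acceptProbWith U V S K η z := by
  refine Eventually.filter_mono nhdsWithin_le_nhds <|
    hZ.eventually_forall_of_forall_eventually fun z _ => ?_
  refine ((continuous_acceptProbWith hU hV hS K).continuousAt.eventually_const_lt ?_).mono
    fun _ h => h.le
  simpa only [acceptProbWith_zero_stepSize] using hϱ

end SmallStepSize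

section RandomThreshold

variable {Ω : Type*} [MeasurableSpace Ω] {μ : Measure Ω}

theorem exists_mem_lt_measure_setOf_forall {ι : Type*} {u : Filter ι} [u.IsCountablyGenerated]
    {P : ι → Ω → Prop} (hP : ∀ᵐ ω ∂μ, ∀ᶠ i in u, P i ω) {c : ℝ≥0∞} (hc : c < μ univ) :
    ∃ s ∈ u, c < μ {ω | ∀ i ∈ s, P i ω} := by
  obtain ⟨B, hB⟩ := u.exists_antitone_basis
  have hmono : Monotone fun n => {ω | ∀ i ∈ B n, P i ω} :=
    fun _ _ hmn _ hω i hi => hω i (hB.antitone hmn hi)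
  have hfull : μ (⋃ n, {ω | ∀ i ∈ B n, P i ω}) = μ univ := by
    refine measure_congr (eventuallyEq_univ.2 ?_)
    filter_upwards [hP] with ω hω
    exact mem_iUnion.2 (hB.mem_iff.1 hω)
  have hlim := tendsto_measure_iUnion_atTop (μ := μ) hmono
  rw [hfull] at hlim
  obtain ⟨n, hn⟩ := (hlim.eventually_const_lt hc).exists
  exact ⟨B n, hB.mem n, hn⟩

theorem exists_lt_measure_forall_le_acceptProbWith {d : ℕ} {U V : Space d → ℝ}
    {S : ℕ → Ω → Space d → ℝ} (hU : Continuous U) (hV : ContDiff ℝ 1 V)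
    (hS : ∀ k, ∀ᵐ ω ∂μ, ContDiff ℝ 1 (S k ω)) (K : ℕ) {Z : Set (Space d × Space d)}
    (hZ : IsCompact Z) {ϱ : ℝ} (hϱ : ϱ < 1) {c : ℝ≥0∞} (hc : c < μ univ) :
    ∃ η₀ > 0, c < μ {ω | ∀ η ∈ Ioc 0 η₀, ∀ z ∈ Z,
      ϱ ≤ acceptProbWith U V (fun k => S k ω) K η z} := by
  have hsmall : ∀ᵐ ω ∂μ, ∀ᶠ η in 𝓝[>] 0, ∀ z ∈ Z,
      ϱ ≤ acceptProbWith U V (fun k => S k ω) K η z := by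
    filter_upwards [ae_all_iff.2 hS] with ω hω
    exact eventually_forall_le_acceptProbWith hU hV hω K hZ hϱ
  obtain ⟨s, hs, hcs⟩ := exists_mem_lt_measure_setOf_forall hsmall hc
  obtain ⟨η₀, hη₀, hsub⟩ := mem_nhdsGT_iff_exists_Ioc_subset.1 hs
  exact ⟨η₀, hη₀, hcs.trans_le (measure_mono fun ω hω η hη => hω η (hsub hη))⟩

end RandomThreshold

section Integrability

variable {Ω : Type*} [MeasurableSpace Ω] {μ : Measure Ω}

theorem aemeasurable_eval_of_ae_continuous {E F : Type*} [TopologicalSpace E] [TopologicalSpace F]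
    [TopologicalSpace.PseudoMetrizableSpace F] [MeasurableSpace F] [BorelSpace F]
    {G : Ω → E → F} (hG : ∀ x, Measurable fun ω => G ω x) (hcont : ∀ᵐ ω ∂μ, Continuous (G ω))
    {X : Ω → E} (hX : AEStronglyMeasurable X μ) : AEMeasurable (fun ω => G ω (X ω)) μ := by
  obtain ⟨Y, hY, hXY⟩ := hX
  refine aemeasurable_of_tendsto_metrizable_ae atTop (fun n =>
    (SimpleFunc.measurable_bind (hY.approx n) (fun x ω => G ω x) hG).aemeasurable) ?_
  filter_upwards [hcont, hXY] with ω hω hXYω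
  rw [hXYω]
  exact (hω.tendsto _).comp (hY.tendsto_approx ω)

variable {d : ℕ} {U V : Space d → ℝ} {S : ℕ → Ω → Space d → ℝ}

theorem aemeasurable_leapfrog (hV : Continuous (gradient V))
    (hmeas : ∀ k q, Measurable fun ω => gradient (S k ω) q)
    (hcont : ∀ k, ∀ᵐ ω ∂μ, Continuous (gradient (S k ω))) (η : ℝ) (z : Space d × Space d) (K : ℕ) :
    AEMeasurable (fun ω => leapfrog (fun k => S k ω) V η z K) μ := by
  have hgrad : ∀ k {X : Ω → Space d}, AEMeasurable X μ →
      AEMeasurable (fun ω => gradient (S k ω) (X ω)) μ := fun k _ hX =>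
    aemeasurable_eval_of_ae_continuous (hmeas k) (hcont k) hX.aestronglyMeasurable
  induction K with
  | zero => exact aemeasurable_const
  | succ K ih =>
    have hpHalf := ih.snd.sub ((hgrad K ih.fst).const_smul (η / 2))
    have hq := ih.fst.add ((hV.measurable.comp_aemeasurable hpHalf).const_smul η)
    exact hq.prodMk (hpHalf.sub ((hgrad (K + 1) hq).const_smul (η / 2)))

theorem integrable_acceptProbWith [IsFiniteMeasure μ] (hU : Continuous U) (hV : ContDiff ℝ 1 V)
    (hmeas : ∀ k q, Measurable fun ω => gradient (S k ω) q)
    (hS : ∀ k, ∀ᵐ ω ∂μ, ContDiff ℝ 1 (S k ω)) (K : ℕ) (η : ℝ) (z : Space d × Space d) :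
    Integrable (fun ω => acceptProbWith U V (fun k => S k ω) K η z) μ := by
  have hflow := aemeasurable_leapfrog (continuous_gradient hV) hmeas
    (fun k => (hS k).mono fun _ => continuous_gradient) η z K
  have hH := (continuous_hamiltonian hU hV.continuous).measurable.comp_aemeasurable hflow
  have hA : AEMeasurable (fun ω => acceptProbWith U V (fun k => S k ω) K η z) μ :=
    (aemeasurable_const.min (aemeasurable_const.sub hH)).exp
  refine Integrable.of_bound hA.aestronglyMeasurable 1 (ae_of_all _ fun ω => ?_)
  rw [acceptProbWith, Real.norm_eq_abs, Real.abs_exp]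
  exact Real.exp_le_one_iff.2 (min_le_left _ _)

theorem mul_le_integral_of_ofReal_le_measure [IsFiniteMeasure μ] {X : Ω → ℝ} (hX : 0 ≤ᵐ[μ] X)
    (hint : Integrable X μ) {a c : ℝ} (ha : 0 ≤ a)
    (hc : ENNReal.ofReal c ≤ μ {ω | a ≤ X ω}) : a * c ≤ ∫ ω, X ω ∂μ := by
  have hreal : c ≤ μ.real {ω | a ≤ X ω} :=
    (ENNReal.ofReal_le_iff_le_toReal (measure_ne_top _ _)).1 hc
  exact (mul_le_mul_of_nonneg_left hreal ha).trans (mul_meas_ge_le_integral_of_nonneg hX hint a)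

end Integrability

section Acceptance

variable {d : ℕ} {U V : Space d → ℝ} {Z : Set (Space d × Space d)}

theorem exists_forall_le_acceptProb (hU : ContDiff ℝ 1 U) (hV : ContDiff ℝ 1 V)
    (hZ : IsCompact Z) {ϱ : ℝ} (hϱ : ϱ < 1) (K : ℕ) :
    ∃ η₀ > 0, ∀ η ∈ Ioc 0 η₀, ∀ z ∈ Z, ϱ ≤ acceptProb U V K η z :=
  mem_nhdsGT_iff_exists_Ioc_subset.1 <|
    eventually_forall_le_acceptProbWith hU.continuous hV (fun _ => hU) K hZ hϱ

theorem exists_forall_le_integral_and_le_measure_acceptProbWith {Ω : Type*}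
    [MeasurableSpace Ω] {μ : Measure Ω} [IsProbabilityMeasure μ] {S : ℕ → Ω → Space d → ℝ}
    (hU : Continuous U) (hV : ContDiff ℝ 1 V)
    (hmeas : ∀ k q, Measurable fun ω => gradient (S k ω) q)
    (hS : ∀ k, ∀ᵐ ω ∂μ, ContDiff ℝ 1 (S k ω)) (hZ : IsCompact Z) {ϱ c : ℝ} (hϱ : ϱ < 1)
    (hc : c < 1) (K : ℕ) :
    ∃ η₀ > 0, ∀ η ∈ Ioc 0 η₀, ∀ z ∈ Z,
      ϱ ≤ ∫ ω, acceptProbWith U V (fun k => S k ω) K η z ∂μ ∧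
      ENNReal.ofReal c ≤ μ {ω | ϱ ≤ acceptProbWith U V (fun k => S k ω) K η z} := by
  obtain ⟨s, hs0, hs1, hms⟩ : ∃ s : ℝ, 0 ≤ s ∧ s < 1 ∧ max ϱ c ≤ s * s := by
    refine ⟨√(max ϱ c), Real.sqrt_nonneg _, ?_, ?_⟩
    · rw [Real.sqrt_lt' one_pos, one_pow]
      exact max_lt hϱ hc
    · rw [← sq, Real.sq_sqrt']
      exact le_max_left _ _
  have hϱs : ϱ ≤ s * s := (le_max_left _ _).trans hms
  have hcs : c ≤ s * s := (le_max_right _ _).trans hms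
  have hss : s * s ≤ s := mul_le_of_le_one_left hs0 hs1.le
  obtain ⟨η₀, hη₀, hgood⟩ := exists_lt_measure_forall_le_acceptProbWith (μ := μ) hU hV hS K hZ hs1
    (c := ENNReal.ofReal s) (by rwa [measure_univ, ENNReal.ofReal_lt_one])
  refine ⟨η₀, hη₀, fun η hη z hz => ?_⟩
  have haccept : ENNReal.ofReal s ≤
      μ {ω | s ≤ acceptProbWith U V (fun k => S k ω) K η z} :=
    hgood.le.trans (measure_mono fun ω hω => hω η hη z hz)
  constructor
  · exact hϱs.trans <| mul_le_integral_of_ofReal_le_measure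
      (ae_of_all μ fun ω => (Real.exp_pos _).le)
      (integrable_acceptProbWith hU hV hmeas hS K η z) hs0 haccept
  · exact (ENNReal.ofReal_le_ofReal (hcs.trans hss)).trans <|
      haccept.trans (measure_mono fun ω hω => (hϱs.trans hss).trans hω)

end Acceptance

end HMC

theorem mainTheorem9_general {d : ℕ} {U V : HMC.Space d → ℝ} (hU : Continuous U)
    (hV : ContDiff ℝ 1 V) (hUint : Integrable fun q => Real.exp (-U q))
    (hVint : Integrable fun p => Real.exp (-V p)) :
    (ContDiff ℝ 1 U → ∀ ϱ < 1, ∀ δ > 0, ∀ K : ℕ,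
      ∃ η₀ : ℝ, 0 < η₀ ∧ ∀ η ∈ Set.Ioc (0 : ℝ) η₀,
        ∃ D : Set (HMC.Space d × HMC.Space d), MeasurableSet D ∧
          ENNReal.ofReal (1 - δ) ≤ HMC.jointLaw U V D ∧
          ∀ z ∈ D, ϱ ≤ HMC.acceptProb U V K η z) ∧
    (∀ (Ω : Type*) [MeasurableSpace Ω] (μ : Measure Ω) [IsProbabilityMeasure μ]
      (S : ℕ → Ω → HMC.Space d → ℝ), (∀ k q, Measurable fun ω => gradient (S k ω) q) →
      (∀ k, ∀ᵐ ω ∂μ, ContDiff ℝ 1 (S k ω)) → ∀ ϱ < 1, ∀ δ > 0, ∀ K : ℕ,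
      ∃ η₀ : ℝ, 0 < η₀ ∧ ∀ η ∈ Set.Ioc (0 : ℝ) η₀,
        ∃ D : Set (HMC.Space d × HMC.Space d), MeasurableSet D ∧
          ENNReal.ofReal (1 - δ) ≤ HMC.jointLaw U V D ∧
          ∀ z ∈ D,
            ϱ ≤ ∫ ω, HMC.acceptProbWith U V (fun k => S k ω) K η z ∂μ ∧
            ENNReal.ofReal (1 - δ) ≤
              μ {ω | ϱ ≤ HMC.acceptProbWith U V (fun k => S k ω) K η z}) := by
  constructor
  · intro hU' ϱ hϱ δ hδ K
    obtain ⟨D, hD, hDδ⟩ := HMC.exists_isCompact_le_jointLaw hUint hVint hδ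
    obtain ⟨η₀, hη₀, h⟩ := HMC.exists_forall_le_acceptProb hU' hV hD hϱ K
    exact ⟨η₀, hη₀, fun η hη => ⟨D, hD.measurableSet, hDδ, h η hη⟩⟩
  · intro Ω _ μ _ S hmeas hS ϱ hϱ δ hδ K
    obtain ⟨D, hD, hDδ⟩ := HMC.exists_isCompact_le_jointLaw hUint hVint hδ
    obtain ⟨η₀, hη₀, h⟩ := HMC.exists_forall_le_integral_and_le_measure_acceptProbWith hU hV
      hmeas hS hD hϱ (sub_lt_self 1 hδ) K
    exact ⟨η₀, hη₀, fun η hη => ⟨D, hD.measurableSet, hDδ, h η hη⟩⟩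

theorem mainTheorem9 {d : ℕ} (U V : HMC.Space d → ℝ) (lU LU lV LV TV : ℝ)
    (hU : HMC.InClassS lU LU U) (hV : HMC.InClassS lV LV V) (hV3 : HMC.ThirdDerivBound TV V) :
    -- exact gradients
    (∀ TU : ℝ, HMC.ThirdDerivBound TU U →
      ∀ ϱ ∈ Set.Ioo (0 : ℝ) 1, ∀ δ ∈ Set.Ioo (0 : ℝ) 1, ∀ K : ℕ, 1 ≤ K →
        ∃ η₀ : ℝ, 0 < η₀ ∧ ∀ η ∈ Set.Ioc (0 : ℝ) η₀,
          ∃ D : Set (HMC.Space d × HMC.Space d), MeasurableSet D ∧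
            ENNReal.ofReal (1 - δ) ≤ HMC.jointLaw U V D ∧
            ∀ z ∈ D, ϱ ≤ HMC.acceptProb U V K η z) ∧
    -- stochastic gradients
    (∀ (Ω : Type*) [MeasurableSpace Ω] (μ : MeasureTheory.Measure Ω)
      [MeasureTheory.IsProbabilityMeasure μ] (l L T : ℝ) (S : ℕ → Ω → HMC.Space d → ℝ),
      HMC.StochasticGradient μ l L T S →
      ∀ ϱ ∈ Set.Ioo (0 : ℝ) 1, ∀ δ ∈ Set.Ioo (0 : ℝ) 1, ∀ K : ℕ, 1 ≤ K →
        ∃ η₀ : ℝ, 0 < η₀ ∧ ∀ η ∈ Set.Ioc (0 : ℝ) η₀,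
          ∃ D : Set (HMC.Space d × HMC.Space d), MeasurableSet D ∧
            ENNReal.ofReal (1 - δ) ≤ HMC.jointLaw U V D ∧
            ∀ z ∈ D,
              ϱ ≤ ∫ ω, HMC.acceptProbWith U V (fun k => S k ω) K η z ∂μ ∧
              ENNReal.ofReal (1 - δ) ≤
                μ {ω | ϱ ≤ HMC.acceptProbWith U V (fun k => S k ω) K η z}) := by
  have h := mainTheorem9_general hU.differentiable.continuous hV.contDiff_one
    hU.integrable_exp_neg hV.integrable_exp_neg
  exact ⟨fun _ _ ϱ hϱ δ hδ K _ => h.1 hU.contDiff_one ϱ hϱ.2 δ hδ.1 K,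
    fun Ω _ μ _ _ _ _ S hS ϱ hϱ δ hδ K _ => h.2 Ω μ S hS.measurable_gradient
      hS.ae_contDiff_one ϱ hϱ.2 δ hδ.1 K⟩
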